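/- Let $f\in C^1(\mathbb{R}^N,\mathbb{R}^N)$, $g\in C^1(\mathbb{R}^N,\mathbb{R}^{N\times M})$ and $h\in C^1(\mathbb{R}^N,\mathbb{R})$ with $f(0)=0$, $h(0)=0$ and $h(x)>0$ for $x\neq 0$, and let $R\in\mathbb{R}^{M\times M}$ be symmetric positive definite. For $x\in\mathbb{R}^N$ and $\mathbf u\in L^\infty([0,\infty);\mathbb{R}^M)$ let $\mathbf x_{\mathbf u}(\cdot;x)$ be the maximal Carathéodory solution of $\dot{\mathbf x}=f(\mathbf x)+g(\mathbf x)\mathbf u(t)$, $\mathbf x(0)=x$, and put $$J_\infty(x,\mathbf u)=\int_0^\infty h(\mathbf x_{\mathbf u}(t;x))+\langle \mathbf u(t),R\mathbf u(t)\rangle\,dt\in[0,\infty],$$ with $J_\infty(x,\mathbf u)=+\infty$ if the solution blows up in finite time. Let $v^*(x)=\inf_{\mathbf u\in L^\infty([0,\infty);\mathbb{R}^M)}J_\infty(x,\mathbf u)$ be the optimal value function. Let $\Omega\subset\mathbb{R}^N$ be open and connected with $0\in\Omega$, and suppose that $v^*$ is finite on $\Omega$ and $v^*\in C^1(\Omega,\mathbb{R})$.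 Let $v\in C^1(\Omega,\mathbb{R})$ satisfy (1) $v(x)\ge 0$ for all $x\in\Omega$ and $v(0)=0$; (2) $\langle f(x)+g(x)u_v(x),\nabla v(x)\rangle+h(x)+\langle u_v(x),R\,u_v(x)\rangle=0$ for all $x\in\Omega$, where $u_v(x):=-\tfrac12R^{-1}g(x)^{\top}\nabla v(x)$. Then there is a set $\tilde\Omega\subset\Omega$ containing a neighborhood of the origin such that $v(x)=v^*(x)$ for all $x\in\tilde\Omega$ and $u_v$ is an optimal feedback on $\tilde\Omega$. The latter means that for every $x\in\tilde\Omega$ the closed-loop system $\dot{\mathbf x}=f(\mathbf x)+g(\mathbf x)u_v(\mathbf x)$, $\mathbf x(0)=x$, has a classical solution on $[0,\infty)$, that no solution of it (on any interval $[0,T]$) leaves $\tilde\Omega$, and that for every solution $\mathbf x$ on $[0,\infty)$ the input $t\mapsto u_v(\mathbf x(t))$ belongs to $L^\infty([0,\infty);\mathbb{R}^M)$ and satisfies $J_\infty(x,u_v(\mathbf x(\cdot)))=v^*(x)$. -/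

import Mathlib

open MeasureTheory Set
open scoped ENNReal Topology

noncomputable section

namespace OptimalControl

/-- The data of an infinite-horizon optimal control problem with state space `ℝ^N` and
input space `ℝ^M`: drift `f`, input matrix `g`, state cost `h` and input weight `R`. -/
structure ControlProblem (N M : ℕ) where
  f : EuclideanSpace ℝ (Fin N) → EuclideanSpace ℝ (Fin N)
  g : EuclideanSpace ℝ (Fin N) → Matrix (Fin N) (Fin M) ℝ
  h : EuclideanSpace ℝ (Fin N) → ℝ
  R : Matrix (Fin M) (Fin M) ℝ

namespace ControlProblem

variable {N M : ℕ} (P : ControlProblem N M)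

/-- The standing assumptions on the data: `f`, `g`, `h` are of class `C¹` on the whole space,
`R` is symmetric positive definite, `f 0 = 0`, and `h` is positive definite. -/
structure StandingAssumption : Prop where
  contDiff_f : ContDiff ℝ 1 P.f
  contDiff_g : ∀ i j, ContDiff ℝ 1 (fun x => P.g x i j)
  contDiff_h : ContDiff ℝ 1 P.h
  posDef_R : P.R.PosDef
  f_zero : P.f 0 = 0
  h_zero : P.h 0 = 0
  h_pos : ∀ x, x ≠ 0 → 0 < P.h x

/-- The right-hand side `f(x) + g(x) u` of the control-affine system. -/
def dynamics (x : EuclideanSpace ℝ (Fin N)) (u : EuclideanSpace ℝ (Fin M)) :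
    EuclideanSpace ℝ (Fin N) :=
  P.f x + Matrix.toEuclideanLin (P.g x) u

/-- The running cost `h(x) + ⟨u, R u⟩`. -/
def runningCost (x : EuclideanSpace ℝ (Fin N)) (u : EuclideanSpace ℝ (Fin M)) : ℝ :=
  P.h x + inner ℝ u (Matrix.toEuclideanLin P.R u)

/-- The admissible inputs `L^∞([0,∞); ℝ^M)`. An input is a function on `ℝ` of which only the
restriction to `[0,∞)` is used. -/
def IsAdmissible (u : ℝ → EuclideanSpace ℝ (Fin M)) : Prop :=
  MemLp u ∞ (volume.restrict (Ici (0 : ℝ)))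

/-- `y` is a Carathéodory solution on `[0,∞)` of `y' = f(y) + g(y) u`, `y(0) = x`: it is
continuous and satisfies the integral equation (with an integrable integrand), that is, it is
locally absolutely continuous and satisfies the differential equation almost everywhere. -/
def IsTrajectory (x : EuclideanSpace ℝ (Fin N)) (u : ℝ → EuclideanSpace ℝ (Fin M))
    (y : ℝ → EuclideanSpace ℝ (Fin N)) : Prop :=
  ContinuousOn y (Ici 0) ∧
    ∀ t, 0 ≤ t →
      IntervalIntegrable (fun s => P.dynamics (y s) (u s)) volume 0 t ∧
        y t = x + ∫ s in (0 : ℝ)..t, P.dynamics (y s) (u s)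

/-- The cost `J_∞(x,u)` with values in `[0,∞]`. For data of class `C¹` there is at most one
trajectory on `[0,∞)` (up to its irrelevant values at negative times), and then the infimum is
the cost of that trajectory; if there is none, that is, if the maximal solution
escapes in finite time, then the infimum is over the empty set and the cost is `+∞`. -/
def cost (x : EuclideanSpace ℝ (Fin N)) (u : ℝ → EuclideanSpace ℝ (Fin M)) : ℝ≥0∞ :=
  ⨅ (y : ℝ → EuclideanSpace ℝ (Fin N)) (_ : P.IsTrajectory x u y),
    ∫⁻ t in Ici (0 : ℝ), ENNReal.ofReal (P.runningCost (y t) (u t))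

/-- The optimal value function `v*(x) = inf_u J_∞(x,u)`, with values in `[0,∞]`. -/
def valueFunction (x : EuclideanSpace ℝ (Fin N)) : ℝ≥0∞ :=
  ⨅ (u : ℝ → EuclideanSpace ℝ (Fin M)) (_ : IsAdmissible u), P.cost x u

/-- `v* ∈ C¹(Ω, ℝ)`: the value function is finite on `Ω` and continuously differentiable there. -/
def ValueFunctionContDiffOn (Ω : Set (EuclideanSpace ℝ (Fin N))) : Prop :=
  (∀ x ∈ Ω, P.valueFunction x ≠ ∞) ∧ ContDiffOn ℝ 1 (fun x => (P.valueFunction x).toReal) Ω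

/-- The feedback law `u_v(x) = -½ R⁻¹ g(x)ᵀ ∇v(x)`. -/
def feedback (v : EuclideanSpace ℝ (Fin N) → ℝ) (x : EuclideanSpace ℝ (Fin N)) :
    EuclideanSpace ℝ (Fin M) :=
  -(1 / 2 : ℝ) • Matrix.toEuclideanLin (P.R⁻¹ * (P.g x).transpose) (gradient v x)

/-- The HJB identity `⟨f(x) + g(x) u_v(x), ∇v(x)⟩ + h(x) + ⟨u_v(x), R u_v(x)⟩ = 0` on `Ω`. -/
def SatisfiesHJB (v : EuclideanSpace ℝ (Fin N) → ℝ) (Ω : Set (EuclideanSpace ℝ (Fin N))) :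
    Prop :=
  ∀ x ∈ Ω, inner ℝ (P.dynamics x (P.feedback v x)) (gradient v x) +
    P.runningCost x (P.feedback v x) = 0

/-- `y` is a classical solution on the time interval `I` (which contains `0`) of the closed-loop
system `y' = f(y) + g(y) k(y)`, `y(0) = x`, for the feedback law `k`. -/
def IsClosedLoop (k : EuclideanSpace ℝ (Fin N) → EuclideanSpace ℝ (Fin M))
    (x : EuclideanSpace ℝ (Fin N)) (I : Set ℝ) (y : ℝ → EuclideanSpace ℝ (Fin N)) : Prop :=
  y 0 = x ∧ ∀ t ∈ I, HasDerivWithinAt y (P.dynamics (y t) (k (y t))) I t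

/-- `k` is an optimal feedback on `S`: from every initial state `x ∈ S`
* the closed-loop system has a solution on `[0,∞)`;
* closed-loop solutions do not leave `S`;
* along every closed-loop solution `y` on `[0,∞)` the input `t ↦ k(y(t))` is admissible and
  attains the infimum that defines `v*(x)`.

A continuous feedback need not make closed-loop solutions unique, hence the quantifiers
over all of them. -/
def IsOptimalFeedbackOn (k : EuclideanSpace ℝ (Fin N) → EuclideanSpace ℝ (Fin M))
    (S : Set (EuclideanSpace ℝ (Fin N))) : Prop :=
  ∀ x ∈ S,
    (∃ y, P.IsClosedLoop k x (Ici 0) y) ∧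
    (∀ T, 0 ≤ T → ∀ y, P.IsClosedLoop k x (Icc 0 T) y → ∀ t ∈ Icc 0 T, y t ∈ S) ∧
    (∀ y, P.IsClosedLoop k x (Ici 0) y →
      IsAdmissible (fun t => k (y t)) ∧ P.cost x (fun t => k (y t)) = P.valueFunction x)

end ControlProblem

end OptimalControl

end

/-! Completing the square in the Hamiltonian turns the HJB identity into `⟨f + g u, ∇v⟩ + h + ⟨u, R
u⟩ = ⟨u - u_v, R (u - u_v)⟩ ≥ 0`. Hence along any trajectory in `Ω`, `v` plus the cost spent so far
never decreases, and under the feedback it is constant. Both inequalities between `v` and the value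
function come from this.

Lower bound. A trajectory that stays in a compact ball inside `Ω` either has infinite cost or comes
to points where `v` is arbitrarily small, since otherwise `h` would be bounded below along it; so it
costs at least `v x`. A trajectory that leaves the ball must cross an annulus, where speed is at
most `C` times running cost, and so pays at least `(r - ρ) / C`. Restricting to a level `v < m ≤ (r
- ρ) / C` covers this case too (`ofReal_le_valueFunction`).

Upper bound. `v` is positive off the origin, so it has a positive lower bound on the sphere of
radius `ρ`. As `v` decreases along closed-loop solutions, the set `‖x‖ < ρ`, `v x < m` is invariant
for small `m`, and the cost of such a solution is at most `v x` (`isAdmissible_and_cost_le`). The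
feedback is merely continuous, so existence comes from Peano's theorem for a truncated field. -/

namespace OptimalControl

/-! ### Peano's theorem by Euler polygons -/

section Peano

variable {E : Type*} [NormedAddCommGroup E] [NormedSpace ℝ E]

/-- The nodes of the explicit Euler scheme with step `δ`. -/
noncomputable def eulerNode (F : E → E) (x : E) (δ : ℝ) : ℕ → E
  | 0 => x
  | k + 1 => eulerNode F x δ k + δ • F (eulerNode F x δ k)

/-- The step function through the nodes of the explicit Euler scheme. -/
noncomputable def eulerStep (F : E → E) (x : E) (δ : ℝ) (t : ℝ) : E :=
  eulerNode F x δ ⌊t / δ⌋₊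

/-- The Euler polygon. -/
noncomputable def eulerPolygon (F : E → E) (x : E) (δ : ℝ) (t : ℝ) : E :=
  x + ∫ s in (0 : ℝ)..t, F (eulerStep F x δ s)

variable {F : E → E} {K : ℝ}

theorem intervalIntegrable_eulerStep (hK : ∀ z, ‖F z‖ ≤ K) (x : E) (δ a b : ℝ) :
    IntervalIntegrable (fun s => F (eulerStep F x δ s)) volume a b := by
  have hm : StronglyMeasurable (fun s => F (eulerStep F x δ s)) := by
    have h1 : StronglyMeasurable (fun k : ℕ => F (eulerNode F x δ k)) :=
      StronglyMeasurable.of_discrete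
    have h2 : Measurable (fun s : ℝ => ⌊s / δ⌋₊) :=
      Nat.measurable_floor.comp (measurable_id.div_const δ)
    exact h1.comp_measurable h2
  refine (intervalIntegrable_const (c := K)).mono_fun hm.aestronglyMeasurable ?_
  exact Filter.Eventually.of_forall fun s => (hK _).trans (le_abs_self K)

/-- The Lipschitz constant is independent of `δ`: this gives both pointwise compactness and
equicontinuity of the polygons. -/
theorem norm_eulerPolygon_sub_le (hK : ∀ z, ‖F z‖ ≤ K) (x : E) (δ s t : ℝ) :
    ‖eulerPolygon F x δ t - eulerPolygon F x δ s‖ ≤ K * |t - s| := by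
  have : eulerPolygon F x δ t - eulerPolygon F x δ s
      = ∫ r in s..t, F (eulerStep F x δ r) := by
    rw [eulerPolygon, eulerPolygon, add_sub_add_left_eq_sub]
    exact intervalIntegral.integral_interval_sub_left
      (intervalIntegrable_eulerStep hK x δ _ _) (intervalIntegrable_eulerStep hK x δ _ _)
  rw [this]
  exact intervalIntegral.norm_integral_le_of_norm_le_const fun r _ => hK _

theorem eulerPolygon_node [CompleteSpace E] (hK : ∀ z, ‖F z‖ ≤ K) (x : E) {δ : ℝ} (hδ : 0 < δ)
    (k : ℕ) : eulerPolygon F x δ (k * δ) = eulerNode F x δ k := by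
  induction k with
  | zero => simp [eulerPolygon, eulerNode]
  | succ k ih =>
    have h1 : ∫ s in (k * δ)..((k + 1 : ℕ) * δ), F (eulerStep F x δ s)
        = ∫ s in (k * δ)..((k + 1 : ℕ) * δ), F (eulerNode F x δ k) := by
      -- The floor jumps at the right endpoint, so the integrands are compared on the open cell
      -- only.
      refine intervalIntegral.integral_congr_Ioo_of_le (by push_cast; nlinarith) ?_
      intro s hs
      have : ⌊s / δ⌋₊ = k := by
        rw [Nat.floor_eq_iff (div_nonneg (le_trans (by positivity) hs.1.le) hδ.le)]
        refine ⟨(le_div_iff₀ hδ).2 hs.1.le, (div_lt_iff₀ hδ).2 ?_⟩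
        have := hs.2
        push_cast at this
        exact this
      simp only [eulerStep, this]
    have h2 := intervalIntegral.integral_add_adjacent_intervals
      (intervalIntegrable_eulerStep hK x δ 0 (k * δ))
      (intervalIntegrable_eulerStep hK x δ (k * δ) ((k + 1 : ℕ) * δ))
    rw [eulerPolygon, ← h2, ← add_assoc, h1, eulerNode, ← ih, eulerPolygon]
    congr 1
    rw [intervalIntegral.integral_const]
    congr 1
    push_cast
    ring

/-- The step function is the polygon evaluated at the left end of the current cell, at most `δ`
earlier. -/
theorem norm_eulerStep_sub_le [CompleteSpace E] (hK : ∀ z, ‖F z‖ ≤ K) (x : E) {δ : ℝ}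
    (hδ : 0 < δ) {s : ℝ} (hs : 0 ≤ s) :
    ‖eulerStep F x δ s - eulerPolygon F x δ s‖ ≤ K * δ := by
  have hK0 : 0 ≤ K := (norm_nonneg _).trans (hK x)
  rw [eulerStep, ← eulerPolygon_node hK x hδ]
  refine (norm_eulerPolygon_sub_le hK x δ _ _).trans (mul_le_mul_of_nonneg_left ?_ hK0)
  have h1 := (le_div_iff₀ hδ).1 (Nat.floor_le (div_nonneg hs hδ.le))
  have h2 := (div_lt_iff₀ hδ).1 (Nat.lt_floor_add_one (s / δ))
  rw [abs_le]
  constructor <;> nlinarith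

/-- **Peano's theorem**, global version for a bounded continuous vector field on a
finite-dimensional space. -/
theorem exists_global_solution_of_continuous_of_bounded [ProperSpace E]
    (hF : Continuous F) (hK : ∀ z, ‖F z‖ ≤ K) (x : E) :
    ∃ y : ℝ → E, y 0 = x ∧ ∀ t, 0 ≤ t → HasDerivWithinAt y (F (y t)) (Ici 0) t := by
  have hK0 : 0 ≤ K := (norm_nonneg _).trans (hK x)
  let δ : ℕ → ℝ := fun n => 1 / ((n : ℝ) + 1)
  have hδ : ∀ n, 0 < δ n := fun n => Nat.one_div_pos_of_nat
  let p : ℕ → ℝ → E := fun n => eulerPolygon F x (δ n)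
  -- Limits along a nonprincipal ultrafilter exist at every time by compactness, which replaces the
  -- extraction of a subsequence.
  let U : Ultrafilter ℕ := Filter.hyperfilter ℕ
  have hU : (U : Filter ℕ) ≤ Filter.atTop := Nat.hyperfilter_le_atTop
  have hδ0 : Filter.Tendsto δ U (𝓝 0) := tendsto_one_div_add_atTop_nhds_zero_nat.mono_left hU
  have hp0 : ∀ n, p n 0 = x := fun n => by simp [p, eulerPolygon]
  have hpb : ∀ n t, p n t ∈ Metric.closedBall x (K * |t|) := fun n t => by
    have := norm_eulerPolygon_sub_le hK x (δ n) 0 t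
    rw [mem_closedBall_iff_norm, ← hp0 n]
    simpa using this
  have hlim : ∀ t, ∃ z, Filter.Tendsto (fun n => p n t) U (𝓝 z) := fun t => by
    obtain ⟨z, -, hz⟩ := (isCompact_closedBall x (K * |t|)).ultrafilter_le_nhds'
      (U.map fun n => p n t) (Ultrafilter.mem_map.2 (Filter.univ_mem' fun n => hpb n t))
    exact ⟨z, hz⟩
  choose y hy using hlim
  have hy0 : y 0 = x := tendsto_nhds_unique (hy 0) (by simp [hp0])
  have hylip : ∀ s t, ‖y t - y s‖ ≤ K * |t - s| := fun s t =>
    le_of_tendsto ((hy t).sub (hy s)).norm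
      (Filter.Eventually.of_forall fun n => norm_eulerPolygon_sub_le hK x (δ n) s t)
  have hyc : Continuous y := by
    refine (LipschitzWith.of_dist_le_mul (K := K.toNNReal) fun t s => ?_).continuous
    rw [dist_eq_norm, Real.dist_eq, Real.coe_toNNReal K hK0]
    exact hylip s t
  have hunif : ∀ t, 0 ≤ t → ∀ η > 0, ∀ᶠ n in (U : Filter ℕ), ∀ s ∈ Icc 0 t,
      ‖p n s - y s‖ < η := by
    intro t ht η hη
    have hequi : Equicontinuous (fun (n : ℕ) (s : Icc 0 t) => p n s) := by
      refine (LipschitzWith.uniformEquicontinuous _ K.toNNReal fun n => ?_).equicontinuous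
      refine LipschitzWith.of_dist_le_mul fun a b => ?_
      rw [dist_eq_norm, Subtype.dist_eq, Real.dist_eq, Real.coe_toNNReal K hK0]
      exact norm_eulerPolygon_sub_le hK x (δ n) b a
    have h1 := (hequi.tendsto_uniformFun_iff_pi (U : Filter ℕ) (fun s : Icc 0 t => y s)).2
      (tendsto_pi_nhds.2 fun s => hy s)
    rw [UniformFun.tendsto_iff_tendstoUniformly] at h1
    filter_upwards [Metric.tendstoUniformly_iff.1 h1 η hη] with n hn s hs
    have := hn ⟨s, hs⟩
    rw [dist_comm, dist_eq_norm] at this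
    exact this
  have hFy : Continuous fun s => F (y s) := hF.comp hyc
  have hint : ∀ t, 0 ≤ t → y t = x + ∫ s in (0 : ℝ)..t, F (y s) := by
    intro t ht
    have h1 : Filter.Tendsto (fun n => p n t) U (𝓝 (x + ∫ s in (0 : ℝ)..t, F (y s))) := by
      refine Filter.Tendsto.const_add x ?_
      rw [Metric.tendsto_nhds]
      intro ε hε
      -- `K * t` bounds the displacement of the polygons and of `y`, `K` bounds the lag `K * δ n`,
      -- and `1` is slack. The tolerance `ε / (t + 1)` stays meaningful at `t = 0`.
      have hcomp : IsCompact (Metric.closedBall x (K * t + K + 1)) := isCompact_closedBall _ _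
      have huc := Metric.uniformContinuousOn_iff.1
        (hcomp.uniformContinuousOn_of_continuous hF.continuousOn) (ε / (t + 1)) (by positivity)
      obtain ⟨η, hη, hηF⟩ := huc
      have h2 : ∀ᶠ n in (U : Filter ℕ), K * δ n < η / 2 := by
        have : Filter.Tendsto (fun n => K * δ n) U (𝓝 (K * 0)) := hδ0.const_mul K
        rw [mul_zero] at this
        exact this.eventually (gt_mem_nhds (by positivity))
      filter_upwards [hunif t ht (η / 2) (by positivity), h2] with n hn hn2
      have hδ1 : δ n ≤ 1 := by
        simp only [δ]
        rw [div_le_one (by positivity)]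
        linarith [(Nat.cast_nonneg n : (0 : ℝ) ≤ n)]
      rw [dist_eq_norm, ← intervalIntegral.integral_sub
        (intervalIntegrable_eulerStep hK x _ _ _) (hFy.intervalIntegrable _ _)]
      have hle : ‖∫ s in (0 : ℝ)..t, F (eulerStep F x (δ n) s) - F (y s)‖
          ≤ ε / (t + 1) * |t - 0| := by
        refine intervalIntegral.norm_integral_le_of_norm_le_const fun s hs => ?_
        rw [uIoc_of_le ht] at hs
        have hs' : s ∈ Icc 0 t := ⟨hs.1.le, hs.2⟩
        have hstep := norm_eulerStep_sub_le hK x (hδ n) hs.1.le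
        have hKs : K * s ≤ K * t := mul_le_mul_of_nonneg_left hs.2 hK0
        have hKδ : K * δ n ≤ K * 1 := mul_le_mul_of_nonneg_left hδ1 hK0
        have hpn := hpb n s
        rw [mem_closedBall_iff_norm, abs_of_nonneg hs.1.le] at hpn
        rw [← dist_eq_norm]
        refine (hηF _ ?_ _ ?_ ?_).le
        · rw [mem_closedBall_iff_norm]
          have := norm_sub_le_norm_sub_add_norm_sub (eulerStep F x (δ n) s) (p n s) x
          linarith
        · rw [mem_closedBall_iff_norm]
          have := hylip 0 s
          rw [hy0, sub_zero, abs_of_nonneg hs.1.le] at this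
          linarith
        · rw [dist_eq_norm]
          have := norm_sub_le_norm_sub_add_norm_sub (eulerStep F x (δ n) s) (p n s) (y s)
          linarith [hn s hs']
      refine hle.trans_lt ?_
      rw [sub_zero, abs_of_nonneg ht, div_mul_eq_mul_div, div_lt_iff₀ (by positivity)]
      nlinarith
    exact tendsto_nhds_unique (hy t) h1
  refine ⟨y, hy0, fun t ht => ?_⟩
  have hd : HasDerivAt (fun t => x + ∫ s in (0 : ℝ)..t, F (y s)) (F (y t)) t :=
    (hFy.integral_hasStrictDerivAt 0 t).hasDerivAt.const_add x
  exact hd.hasDerivWithinAt.congr (fun s hs => hint s hs) (hint t ht)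

end Peano

/-! ### Truncation to a ball -/

/-- The radial retraction onto the closed ball of radius `ρ`. -/
noncomputable def radialRetraction {E : Type*} [NormedAddCommGroup E] [NormedSpace ℝ E] (ρ : ℝ) (x : E) : E :=
  (ρ / max ρ ‖x‖) • x

section Retraction

variable {E : Type*} [NormedAddCommGroup E] [NormedSpace ℝ E] {ρ : ℝ}

theorem continuous_radialRetraction (hρ : 0 < ρ) :
    Continuous (radialRetraction ρ : E → E) := by
  refine (continuous_const.div (continuous_const.max continuous_norm) fun x => ?_).smul
    continuous_id
  exact (lt_max_of_lt_left hρ).ne'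

theorem norm_radialRetraction_le (hρ : 0 < ρ) (x : E) : ‖radialRetraction ρ x‖ ≤ ρ := by
  have h : 0 < max ρ ‖x‖ := lt_max_of_lt_left hρ
  rw [radialRetraction, norm_smul, Real.norm_of_nonneg (by positivity), div_mul_eq_mul_div,
    div_le_iff₀ h]
  exact mul_le_mul_of_nonneg_left (le_max_right _ _) hρ.le

theorem radialRetraction_of_norm_le (hρ : 0 < ρ) {x : E} (hx : ‖x‖ ≤ ρ) :
    radialRetraction ρ x = x := by
  rw [radialRetraction, max_eq_left hx, div_self hρ.ne', one_smul]

end Retraction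

/-! ### Hitting times and crossings -/

/-- A continuous function that climbs from below `b` to at least `b` has a first time at which
it takes the value `b`. -/
theorem exists_first_hit {φ : ℝ → ℝ} {s t b : ℝ} (hst : s ≤ t) (hφ : ContinuousOn φ (Icc s t))
    (hs : φ s ≤ b) (ht : b ≤ φ t) :
    ∃ τ ∈ Icc s t, φ τ = b ∧ ∀ r ∈ Icc s τ, φ r ≤ b := by
  have hcl : IsCompact (Icc s t ∩ φ ⁻¹' Ici b) :=
    isCompact_Icc.of_isClosed_subset (hφ.preimage_isClosed_of_isClosed isClosed_Icc isClosed_Ici)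
      inter_subset_left
  obtain ⟨τ, ⟨hτ, hτb⟩, hmin⟩ := hcl.exists_isLeast ⟨t, ⟨hst, le_rfl⟩, ht⟩
  have hlt : ∀ r ∈ Icc s τ, r < τ → φ r < b := fun r hr hrτ => by
    by_contra! h
    exact (hmin ⟨⟨hr.1, hr.2.trans hτ.2⟩, h⟩).not_gt hrτ
  have heq : φ τ = b := by
    obtain ⟨r, hr, hrb⟩ := intermediate_value_Icc hτ.1
      (hφ.mono (Icc_subset_Icc_right hτ.2)) ⟨hs, hτb⟩
    rcases hr.2.eq_or_lt with h | h
    · rwa [← h]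
    · exact absurd hrb (hlt r hr h).ne
  refine ⟨τ, hτ, heq, fun r hr => ?_⟩
  rcases hr.2.eq_or_lt with h | h
  · rw [h, heq]
  · exact (hlt r hr h).le

/-- A continuous function that climbs from at most `a` to at least `b ≥ a` crosses the strip
between `a` and `b`. -/
theorem exists_crossing {φ : ℝ → ℝ} {s t a b : ℝ} (hst : s ≤ t) (hφ : ContinuousOn φ (Icc s t))
    (hab : a ≤ b) (hs : φ s ≤ a) (ht : b ≤ φ t) :
    ∃ σ τ, s ≤ σ ∧ σ ≤ τ ∧ τ ≤ t ∧ φ σ = a ∧ φ τ = b ∧ ∀ r ∈ Icc σ τ, a ≤ φ r ∧ φ r ≤ b := by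
  obtain ⟨τ, hτ, hτb, hle⟩ := exists_first_hit hst hφ (hs.trans hab) ht
  -- The last visit to `a` before `τ` is a first hit after reversing both time and sign.
  have hcont : ContinuousOn (fun r => -φ (-r)) (Icc (-τ) (-s)) := by
    refine (hφ.comp continuous_neg.continuousOn fun r hr => ?_).neg
    simp only [mem_Icc] at hr hτ ⊢
    constructor <;> linarith
  obtain ⟨σ, hσ, hσa, hge⟩ := exists_first_hit (b := -a) (neg_le_neg hτ.1) hcont
    (by simp only [neg_neg]; linarith) (by simp only [neg_neg]; linarith)
  have hσ1 : s ≤ -σ := by linarith [hσ.2]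
  refine ⟨-σ, τ, hσ1, by linarith [hσ.1], hτ.2, by linarith, hτb, fun r hr => ⟨?_, ?_⟩⟩
  · have := hge (-r) ⟨by linarith [hr.2], by linarith [hr.1]⟩
    rw [neg_neg] at this
    linarith
  · exact hle r ⟨hσ1.trans hr.1, hr.2⟩

/-! ### Matrices acting on Euclidean space -/

theorem toEuclideanLin_mul_apply {l m n : ℕ} (A : Matrix (Fin l) (Fin m) ℝ)
    (B : Matrix (Fin m) (Fin n) ℝ) (x : EuclideanSpace ℝ (Fin n)) :
    Matrix.toEuclideanLin (A * B) x = Matrix.toEuclideanLin A (Matrix.toEuclideanLin B x) := by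
  simp [Matrix.toLpLin_apply, Matrix.mulVec_mulVec]

theorem continuousOn_toEuclideanLin_apply {X : Type*} [TopologicalSpace X] {m n : ℕ}
    {A : X → Matrix (Fin m) (Fin n) ℝ} {w : X → EuclideanSpace ℝ (Fin n)} {S : Set X}
    (hA : ∀ i j, ContinuousOn (fun x => A x i j) S) (hw : ContinuousOn w S) :
    ContinuousOn (fun x => Matrix.toEuclideanLin (A x) (w x)) S := by
  have h1 : ContinuousOn (fun x => (A x).mulVec (w x)) S := by
    refine continuousOn_pi.2 fun i => ?_
    simp only [Matrix.mulVec, dotProduct]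
    refine continuousOn_finsetSum _ fun j _ => (hA i j).mul ?_
    exact (EuclideanSpace.proj (𝕜 := ℝ) j).continuous.comp_continuousOn hw
  simp only [Matrix.toLpLin_apply]
  exact (PiLp.continuous_toLp 2 _).comp_continuousOn h1

/-- A symmetric positive definite matrix is coercive. -/
theorem exists_pos_mul_norm_sq_le_inner {m : ℕ} {R : Matrix (Fin m) (Fin m) ℝ} (hR : R.PosDef) :
    ∃ c > 0, ∀ u : EuclideanSpace ℝ (Fin m),
      c * ‖u‖ ^ 2 ≤ inner ℝ u (Matrix.toEuclideanLin R u) := by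
  have hcont : Continuous fun u : EuclideanSpace ℝ (Fin m) =>
      (inner ℝ u (Matrix.toEuclideanLin R u) : ℝ) :=
    continuous_id.inner (LinearMap.continuous_of_finiteDimensional _)
  have hpos : ∀ u : EuclideanSpace ℝ (Fin m), u ≠ 0 →
      0 < (inner ℝ u (Matrix.toEuclideanLin R u) : ℝ) := fun u hu => by
    have := hR.dotProduct_mulVec_pos (x := u.ofLp) (by simpa using hu)
    rw [EuclideanSpace.inner_eq_star_dotProduct, dotProduct_comm]
    exact this
  obtain ⟨c, hc, hle⟩ : ∃ c > 0, ∀ u ∈ Metric.sphere (0 : EuclideanSpace ℝ (Fin m)) 1,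
      c ≤ inner ℝ u (Matrix.toEuclideanLin R u) := by
    -- The sphere is empty when `m = 0`; any positive constant then works.
    rcases (Metric.sphere (0 : EuclideanSpace ℝ (Fin m)) 1).eq_empty_or_nonempty with h | h
    · exact ⟨1, one_pos, by simp [h]⟩
    · obtain ⟨u, hu, hmin⟩ := (isCompact_sphere _ _).exists_isMinOn h hcont.continuousOn
      exact ⟨_, hpos u (ne_zero_of_mem_unit_sphere ⟨u, hu⟩), fun w hw => hmin hw⟩
  refine ⟨c, hc, fun u => ?_⟩
  rcases eq_or_ne u 0 with rfl | hu
  · simp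
  · have hn : 0 < ‖u‖ := norm_pos_iff.2 hu
    have h1 := hle (‖u‖⁻¹ • u) (by simp [norm_smul, hn.ne'])
    rw [map_smul, real_inner_smul_left, real_inner_smul_right, ← mul_assoc] at h1
    have h2 := mul_le_mul_of_nonneg_right h1 (sq_nonneg ‖u‖)
    calc c * ‖u‖ ^ 2 ≤ _ := h2
      _ = _ := by field_simp

/-! ### Hamiltonian, positivity of `v`, and the speed estimate -/

namespace ControlProblem

variable {N M : ℕ} {P : ControlProblem N M}

theorem StandingAssumption.continuous_dynamics (hP : P.StandingAssumption) :
    Continuous fun p : EuclideanSpace ℝ (Fin N) × EuclideanSpace ℝ (Fin M) =>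
      P.dynamics p.1 p.2 := by
  refine (hP.contDiff_f.continuous.comp continuous_fst).add ?_
  rw [← continuousOn_univ]
  exact continuousOn_toEuclideanLin_apply
    (fun i j => ((hP.contDiff_g i j).continuous.comp continuous_fst).continuousOn)
    continuous_snd.continuousOn

theorem StandingAssumption.continuous_runningCost (hP : P.StandingAssumption) :
    Continuous fun p : EuclideanSpace ℝ (Fin N) × EuclideanSpace ℝ (Fin M) =>
      P.runningCost p.1 p.2 :=
  (hP.contDiff_h.continuous.comp continuous_fst).add
    (continuous_snd.inner ((LinearMap.continuous_of_finiteDimensional _).comp continuous_snd))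

theorem StandingAssumption.h_nonneg (hP : P.StandingAssumption) (x : EuclideanSpace ℝ (Fin N)) :
    0 ≤ P.h x := by
  rcases eq_or_ne x 0 with rfl | hx
  · exact hP.h_zero.ge
  · exact (hP.h_pos x hx).le

theorem StandingAssumption.inner_nonneg (hP : P.StandingAssumption)
    (u : EuclideanSpace ℝ (Fin M)) : 0 ≤ (inner ℝ u (Matrix.toEuclideanLin P.R u) : ℝ) := by
  obtain ⟨c, hc, h⟩ := exists_pos_mul_norm_sq_le_inner hP.posDef_R
  exact le_trans (by positivity) (h u)

theorem StandingAssumption.h_le_runningCost (hP : P.StandingAssumption)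
    (x : EuclideanSpace ℝ (Fin N)) (u : EuclideanSpace ℝ (Fin M)) :
    P.h x ≤ P.runningCost x u :=
  le_add_of_nonneg_right (hP.inner_nonneg u)

theorem StandingAssumption.runningCost_nonneg (hP : P.StandingAssumption)
    (x : EuclideanSpace ℝ (Fin N)) (u : EuclideanSpace ℝ (Fin M)) : 0 ≤ P.runningCost x u :=
  (hP.h_nonneg x).trans (hP.h_le_runningCost x u)

/-- Since `R` is invertible, `R u_v = -½ gᵀ ∇v`; moving `g` across the inner product then expresses
the gradient term through `R` alone. -/
theorem StandingAssumption.inner_input_gradient (hP : P.StandingAssumption)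
    (v : EuclideanSpace ℝ (Fin N) → ℝ) (x : EuclideanSpace ℝ (Fin N))
    (u : EuclideanSpace ℝ (Fin M)) :
    (inner ℝ (Matrix.toEuclideanLin (P.g x) u) (gradient v x) : ℝ)
      = -2 * inner ℝ u (Matrix.toEuclideanLin P.R (P.feedback v x)) := by
  have h1 : Matrix.toEuclideanLin P.R (P.feedback v x)
      = -(1 / 2 : ℝ) • Matrix.toEuclideanLin (P.g x).transpose (gradient v x) := by
    have hdet : IsUnit P.R.det := (Matrix.isUnit_iff_isUnit_det _).1 hP.posDef_R.isUnit
    rw [feedback, map_smul, ← toEuclideanLin_mul_apply, ← Matrix.mul_assoc,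
      Matrix.mul_nonsing_inv _ hdet, Matrix.one_mul]
  have h2 : Matrix.toEuclideanLin (P.g x).transpose
      = LinearMap.adjoint (Matrix.toEuclideanLin (P.g x)) := by
    rw [← Matrix.toEuclideanLin_conjTranspose_eq_adjoint,
      Matrix.conjTranspose_eq_transpose_of_trivial]
  rw [h1, real_inner_smul_right, h2, LinearMap.adjoint_inner_right]
  ring

/-- Completing the square in the Hamiltonian. -/
theorem StandingAssumption.inner_dynamics_add_runningCost (hP : P.StandingAssumption)
    (v : EuclideanSpace ℝ (Fin N) → ℝ) (x : EuclideanSpace ℝ (Fin N))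
    (u : EuclideanSpace ℝ (Fin M)) :
    (inner ℝ (P.dynamics x u) (gradient v x) : ℝ) + P.runningCost x u
      = (inner ℝ (P.dynamics x (P.feedback v x)) (gradient v x)
          + P.runningCost x (P.feedback v x))
        + inner ℝ (u - P.feedback v x)
            (Matrix.toEuclideanLin P.R (u - P.feedback v x)) := by
  have hsymm := (Matrix.isSymmetric_toEuclideanLin_iff (A := P.R)).2 hP.posDef_R.isHermitian
  have h1 := hsymm (P.feedback v x) u
  rw [real_inner_comm] at h1
  simp only [dynamics, runningCost, inner_add_left, hP.inner_input_gradient, map_sub,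
    inner_sub_left, inner_sub_right]
  rw [h1]
  ring

/-- HJB cancels the feedback terms in the completed square, and the remaining quadratic form is
nonnegative. -/
theorem StandingAssumption.neg_runningCost_le_fderiv (hP : P.StandingAssumption)
    {v : EuclideanSpace ℝ (Fin N) → ℝ} {Ω : Set (EuclideanSpace ℝ (Fin N))}
    (hHJB : P.SatisfiesHJB v Ω) {x : EuclideanSpace ℝ (Fin N)} (hx : x ∈ Ω)
    (u : EuclideanSpace ℝ (Fin M)) :
    -P.runningCost x u ≤ fderiv ℝ v x (P.dynamics x u) := by
  have h := hP.inner_dynamics_add_runningCost v x u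
  rw [hHJB x hx, ← real_inner_comm, inner_gradient_left] at h
  linarith [hP.inner_nonneg (u - P.feedback v x)]

theorem SatisfiesHJB.fderiv_feedback {v : EuclideanSpace ℝ (Fin N) → ℝ}
    {Ω : Set (EuclideanSpace ℝ (Fin N))} (hHJB : P.SatisfiesHJB v Ω)
    {x : EuclideanSpace ℝ (Fin N)} (hx : x ∈ Ω) :
    fderiv ℝ v x (P.dynamics x (P.feedback v x)) = -P.runningCost x (P.feedback v x) := by
  have h := hHJB x hx
  rw [← real_inner_comm, inner_gradient_left] at h
  linarith

/-- Only continuity is available, because `∇v` is merely continuous. -/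
theorem StandingAssumption.continuousOn_feedback (hP : P.StandingAssumption)
    {v : EuclideanSpace ℝ (Fin N) → ℝ} {Ω : Set (EuclideanSpace ℝ (Fin N))} (hΩ : IsOpen Ω)
    (hv : ContDiffOn ℝ 1 v Ω) : ContinuousOn (P.feedback v) Ω := by
  have hgrad : ContinuousOn (gradient v) Ω :=
    (InnerProductSpace.toDual ℝ (EuclideanSpace ℝ (Fin N))).symm.continuous.comp_continuousOn
      (hv.continuousOn_fderiv_of_isOpen hΩ le_rfl)
  refine (continuousOn_toEuclideanLin_apply (fun i j => ?_) hgrad).const_smul (-(1 / 2 : ℝ))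
  simp only [Matrix.mul_apply, Matrix.transpose_apply]
  exact (continuous_finsetSum _ fun k _ =>
    continuous_const.mul (hP.contDiff_g j k).continuous).continuousOn

/-- A nonnegative solution of the HJB equation is positive definite. -/
theorem StandingAssumption.pos_of_satisfiesHJB (hP : P.StandingAssumption)
    {v : EuclideanSpace ℝ (Fin N) → ℝ} {Ω : Set (EuclideanSpace ℝ (Fin N))} (hΩ : IsOpen Ω)
    (hv_nonneg : ∀ x ∈ Ω, 0 ≤ v x) (hHJB : P.SatisfiesHJB v Ω)
    {x : EuclideanSpace ℝ (Fin N)} (hx : x ∈ Ω) (hx0 : x ≠ 0) : 0 < v x := by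
  refine (hv_nonneg x hx).lt_of_ne fun h0 => ?_
  -- A zero of `v` is a minimum, so `∇v` vanishes there and HJB forces zero running cost, against `h
  -- > 0`.
  have hmin : IsLocalMin v x := by
    filter_upwards [hΩ.mem_nhds hx] with z hz
    rw [← h0]
    exact hv_nonneg z hz
  have h1 := hP.neg_runningCost_le_fderiv hHJB hx (P.feedback v x)
  have h2 := hHJB.fderiv_feedback hx
  rw [hmin.fderiv_eq_zero] at h2
  have h3 := hP.h_le_runningCost x (P.feedback v x)
  have h4 := hP.h_pos x hx0
  simp only [zero_apply] at h2
  linarith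

/-- Away from the origin the speed is dominated by the running cost. -/
theorem StandingAssumption.exists_norm_dynamics_le (hP : P.StandingAssumption) {ρ r : ℝ}
    (hρ : 0 < ρ) :
    ∃ C > 0, ∀ x : EuclideanSpace ℝ (Fin N), ρ ≤ ‖x‖ → ‖x‖ ≤ r →
      ∀ u : EuclideanSpace ℝ (Fin M), ‖P.dynamics x u‖ ≤ C * P.runningCost x u := by
  obtain ⟨l, hl, hlR⟩ := exists_pos_mul_norm_sq_le_inner hP.posDef_R
  have hball : IsCompact (Metric.closedBall (0 : EuclideanSpace ℝ (Fin N)) r) :=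
    isCompact_closedBall _ _
  obtain ⟨c, hc, hch⟩ : ∃ c > 0, ∀ x : EuclideanSpace ℝ (Fin N), ρ ≤ ‖x‖ → ‖x‖ ≤ r →
      c ≤ P.h x := by
    have hS : IsCompact (Metric.closedBall (0 : EuclideanSpace ℝ (Fin N)) r ∩ {x | ρ ≤ ‖x‖}) :=
      hball.inter_right (isClosed_le continuous_const continuous_norm)
    rcases eq_empty_or_nonempty
      (Metric.closedBall (0 : EuclideanSpace ℝ (Fin N)) r ∩ {x | ρ ≤ ‖x‖}) with h | h
    · refine ⟨1, one_pos, fun x h1 h2 => ?_⟩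
      have : x ∈ Metric.closedBall (0 : EuclideanSpace ℝ (Fin N)) r ∩ {x | ρ ≤ ‖x‖} :=
        ⟨mem_closedBall_zero_iff.2 h2, h1⟩
      rw [h] at this
      exact this.elim
    · obtain ⟨x, hx, hmin⟩ := hS.exists_isMinOn h hP.contDiff_h.continuous.continuousOn
      exact ⟨_, hP.h_pos x (norm_pos_iff.1 (hρ.trans_le hx.2)),
        fun z h1 h2 => hmin ⟨mem_closedBall_zero_iff.2 h2, h1⟩⟩
  obtain ⟨A, hA⟩ := (hball.prod (isCompact_closedBall (0 : EuclideanSpace ℝ (Fin M)) 1)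
    ).exists_bound_of_continuousOn hP.continuous_dynamics.continuousOn
  -- The speed grows at most quadratically in `u`, as does the lower bound `c + l * ‖u‖ ^ 2` for the
  -- cost.
  have hspeed : ∀ x : EuclideanSpace ℝ (Fin N), ‖x‖ ≤ r → ∀ u : EuclideanSpace ℝ (Fin M),
      ‖P.dynamics x u‖ ≤ 3 * A * (1 + ‖u‖ ^ 2) := by
    intro x hx u
    have hx' := mem_closedBall_zero_iff.2 hx
    have h0 := hA (x, 0) ⟨hx', by simp⟩
    have hA0 : 0 ≤ A := (norm_nonneg _).trans h0
    rcases le_or_gt ‖u‖ 1 with hu | hu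
    · refine (hA (x, u) ⟨hx', mem_closedBall_zero_iff.2 hu⟩).trans ?_
      nlinarith [sq_nonneg ‖u‖, mul_nonneg hA0 (sq_nonneg ‖u‖)]
    · have hn : 0 < ‖u‖ := one_pos.trans hu
      have h1 := hA (x, ‖u‖⁻¹ • u) ⟨hx', by simp [norm_smul, hn.ne']⟩
      -- The dynamics are affine in `u`, so large inputs reduce to a unit input and the zero input.
      have h2 : P.dynamics x u = ‖u‖ • P.dynamics x (‖u‖⁻¹ • u)
          + (1 - ‖u‖) • P.dynamics x 0 := by
        simp only [dynamics, map_smul, map_zero, add_zero, smul_add, sub_smul, one_smul,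
          smul_smul, mul_inv_cancel₀ hn.ne']
        abel
      have h3 : ‖P.dynamics x u‖ ≤ ‖u‖ * A + (‖u‖ - 1) * A := by
        rw [h2]
        refine (norm_add_le _ _).trans (add_le_add ?_ ?_)
        · rw [norm_smul, norm_norm]
          exact mul_le_mul_of_nonneg_left h1 hn.le
        · rw [norm_smul, Real.norm_eq_abs, abs_sub_comm, abs_of_pos (sub_pos.2 hu)]
          exact mul_le_mul_of_nonneg_left h0 (sub_pos.2 hu).le
      nlinarith [mul_nonneg hA0 (sq_nonneg (‖u‖ - 1)), mul_nonneg hA0 (sq_nonneg ‖u‖)]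
  -- The absolute value covers an empty ball (`r < 0`), where `A` may be negative; the added `1`
  -- makes the constant positive.
  refine ⟨3 * |A| * (1 / c + 1 / l) + 1, by positivity, fun x h1 h2 u => ?_⟩
  have hcost : c + l * ‖u‖ ^ 2 ≤ P.runningCost x u := add_le_add (hch x h1 h2) (hlR u)
  have h3 : 1 + ‖u‖ ^ 2 ≤ (1 / c + 1 / l) * P.runningCost x u := by
    have e1 : (1 / c + 1 / l) * (c + l * ‖u‖ ^ 2)
        = 1 + ‖u‖ ^ 2 + (l / c * ‖u‖ ^ 2 + c / l) := by field_simp; ring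
    have e2 : 0 ≤ l / c * ‖u‖ ^ 2 + c / l := by positivity
    have e3 := mul_le_mul_of_nonneg_left hcost (show 0 ≤ 1 / c + 1 / l by positivity)
    linarith
  calc ‖P.dynamics x u‖ ≤ 3 * A * (1 + ‖u‖ ^ 2) := hspeed x h2 u
    _ ≤ 3 * |A| * (1 + ‖u‖ ^ 2) := by
      have := le_abs_self A
      gcongr
    _ ≤ 3 * |A| * ((1 / c + 1 / l) * P.runningCost x u) := by gcongr
    _ ≤ _ := by linarith [hP.runningCost_nonneg x u]

end ControlProblem

/-! ### Arbitrary trajectories: the lower bound -/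

namespace ControlProblem

variable {N M : ℕ} {P : ControlProblem N M} {x : EuclideanSpace ℝ (Fin N)}
  {u : ℝ → EuclideanSpace ℝ (Fin M)} {y : ℝ → EuclideanSpace ℝ (Fin N)}

theorem IsTrajectory.apply_zero (hy : P.IsTrajectory x u y) : y 0 = x := by
  simpa using (hy.2 0 le_rfl).2

theorem IsTrajectory.sub_eq_integral (hy : P.IsTrajectory x u y) {a b : ℝ} (ha : 0 ≤ a)
    (hb : 0 ≤ b) : y b - y a = ∫ s in a..b, P.dynamics (y s) (u s) := by
  rw [(hy.2 a ha).2, (hy.2 b hb).2, add_sub_add_left_eq_sub]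
  exact intervalIntegral.integral_interval_sub_left (hy.2 b hb).1 (hy.2 a ha).1

/-- Along an admissible input and a continuous curve, a continuous function of state and input
is essentially bounded and integrable on compact time intervals. -/
theorem IsAdmissible.bounded_and_integrableOn {X : Type*} [NormedAddCommGroup X]
    (hu : IsAdmissible u) (hy : ContinuousOn y (Ici 0))
    {G : EuclideanSpace ℝ (Fin N) × EuclideanSpace ℝ (Fin M) → X} (hG : Continuous G) (T : ℝ) :
    (∃ C, ∀ᵐ s ∂volume.restrict (Icc 0 T), ‖G (y s, u s)‖ ≤ C) ∧
      IntegrableOn (fun s => G (y s, u s)) (Icc 0 T) volume := by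
  have hsub : Icc 0 T ⊆ Ici (0 : ℝ) := Icc_subset_Ici_self
  have hle : volume.restrict (Icc 0 T) ≤ volume.restrict (Ici (0 : ℝ)) :=
    Measure.restrict_mono hsub le_rfl
  obtain ⟨A, hA⟩ := isCompact_Icc.exists_bound_of_continuousOn (hy.mono hsub)
  have hB : ∀ᵐ s ∂volume.restrict (Icc 0 T), ‖u s‖
      ≤ (eLpNorm u ∞ (volume.restrict (Ici 0))).toReal := by
    refine ae_mono hle ?_
    have h := ae_le_eLpNormEssSup (f := u) (μ := volume.restrict (Ici (0 : ℝ)))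
    filter_upwards [h] with s hs
    rw [← eLpNorm_exponent_top] at hs
    have := ENNReal.toReal_mono hu.eLpNorm_ne_top hs
    simpa using this
  set B := (eLpNorm u ∞ (volume.restrict (Ici (0 : ℝ)))).toReal
  obtain ⟨C, hC⟩ := ((isCompact_closedBall (0 : EuclideanSpace ℝ (Fin N)) A).prod
    (isCompact_closedBall (0 : EuclideanSpace ℝ (Fin M)) B)).exists_bound_of_continuousOn
      hG.continuousOn
  have hbd : ∀ᵐ s ∂volume.restrict (Icc 0 T), ‖G (y s, u s)‖ ≤ C := by
    filter_upwards [hB, ae_restrict_mem measurableSet_Icc] with s hs hsT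
    exact hC _ ⟨mem_closedBall_zero_iff.2 (hA s hsT), mem_closedBall_zero_iff.2 hs⟩
  refine ⟨⟨C, hbd⟩, Integrable.of_bound ?_ C hbd⟩
  exact hG.comp_aestronglyMeasurable
    (((hy.mono hsub).aestronglyMeasurable measurableSet_Icc).prodMk
      (hu.aestronglyMeasurable.mono_measure hle))

theorem IsAdmissible.intervalIntegrable_runningCost (hu : IsAdmissible u)
    (hP : P.StandingAssumption) (hy : ContinuousOn y (Ici 0)) {a b : ℝ} (ha : 0 ≤ a)
    (hab : a ≤ b) : IntervalIntegrable (fun s => P.runningCost (y s) (u s)) volume a b := by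
  rw [intervalIntegrable_iff_integrableOn_Icc_of_le hab]
  exact (hu.bounded_and_integrableOn hy hP.continuous_runningCost b).2.mono_set
    (Icc_subset_Icc_left ha)

/-- Fundamental theorem of calculus for a `C¹` function along a trajectory. -/
theorem IsTrajectory.integral_fderiv (hP : P.StandingAssumption) (hu : IsAdmissible u)
    (hy : P.IsTrajectory x u y) {v : EuclideanSpace ℝ (Fin N) → ℝ}
    {Ω : Set (EuclideanSpace ℝ (Fin N))} (hΩ : IsOpen Ω) (hv : ContDiffOn ℝ 1 v Ω) {r T : ℝ}
    (hr : Metric.closedBall 0 r ⊆ Ω) (hT : 0 ≤ T) (hyr : ∀ t ∈ Icc 0 T, ‖y t‖ ≤ r) :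
    IntervalIntegrable (fun s => fderiv ℝ v (y s) (P.dynamics (y s) (u s))) volume 0 T ∧
      ∫ s in (0 : ℝ)..T, fderiv ℝ v (y s) (P.dynamics (y s) (u s)) = v (y T) - v x := by
  obtain ⟨C, hC⟩ := (hu.bounded_and_integrableOn hy.1 hP.continuous_dynamics T).1
  rw [ae_restrict_iff' measurableSet_Icc] at hC
  have hdiff : ∀ z ∈ Ω, DifferentiableAt ℝ v z := fun z hz =>
    (hv.differentiableOn one_ne_zero).differentiableAt (hΩ.mem_nhds hz)
  have hyΩ : ∀ t ∈ Icc 0 T, y t ∈ Metric.closedBall (0 : EuclideanSpace ℝ (Fin N)) r :=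
    fun t ht => mem_closedBall_zero_iff.2 (hyr t ht)
  -- An essentially bounded velocity makes `y` Lipschitz, and `v` is Lipschitz on the convex ball.
  -- The composite is thus absolutely continuous, and the fundamental theorem applies with
  -- derivatives almost everywhere.
  have hylip : LipschitzOnWith C.toNNReal y (Icc 0 T) := by
    refine LipschitzOnWith.of_dist_le_mul fun s hs t ht => ?_
    rw [dist_eq_norm, hy.sub_eq_integral ht.1 hs.1, Real.dist_eq]
    refine intervalIntegral.norm_integral_le_of_norm_le_const_ae ?_
    filter_upwards [hC] with τ hτ hmem
    have hτ' : τ ∈ Icc 0 T := by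
      have := uIoc_subset_uIcc hmem
      exact (uIcc_subset_Icc ht hs) this
    exact (hτ hτ').trans (Real.le_coe_toNNReal C)
  obtain ⟨B, hB⟩ := (isCompact_closedBall (0 : EuclideanSpace ℝ (Fin N)) r
    ).exists_bound_of_continuousOn ((hv.continuousOn_fderiv_of_isOpen hΩ le_rfl).mono hr)
  have hvlip : LipschitzOnWith B.toNNReal v (Metric.closedBall 0 r) := by
    refine Convex.lipschitzOnWith_of_nnnorm_fderiv_le (𝕜 := ℝ) (fun z hz => hdiff z (hr hz))
      (fun z hz => ?_) (convex_closedBall _ _)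
    rw [← NNReal.coe_le_coe, coe_nnnorm]
    exact (hB z hz).trans (Real.le_coe_toNNReal B)
  have hac : AbsolutelyContinuousOnInterval (fun t => v (y t)) 0 T := by
    refine LipschitzOnWith.absolutelyContinuousOnInterval
      (K := B.toNNReal * C.toNNReal) ?_
    rw [uIcc_of_le hT]
    exact hvlip.comp hylip hyΩ
  have hderiv : ∀ᵐ s, s ∈ uIoc 0 T →
      deriv (fun t => v (y t)) s = fderiv ℝ v (y s) (P.dynamics (y s) (u s)) := by
    have hne : ∀ᵐ s : ℝ, s ≠ T := by simp [ae_iff, measure_singleton]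
    filter_upwards [(hy.2 T hT).1.ae_hasDerivAt_integral, hne] with s hs hsT hmem
    have hs1 := hs (uIoc_subset_uIcc hmem) 0 left_mem_uIcc
    rw [uIoc_of_le hT] at hmem
    have hyd : HasDerivAt y (P.dynamics (y s) (u s)) s := by
      refine (hs1.const_add x).congr_of_eventuallyEq ?_
      filter_upwards [Ioi_mem_nhds hmem.1] with t ht
      exact (hy.2 t (le_of_lt ht)).2
    exact ((hdiff _ (hr (hyΩ s ⟨hmem.1.le, hmem.2⟩))).hasFDerivAt.comp_hasDerivAt s hyd).deriv
  refine ⟨hac.intervalIntegrable_deriv.congr_ae ?_, ?_⟩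
  · rwa [Filter.EventuallyEq, ae_restrict_iff' measurableSet_uIoc]
  · rw [← intervalIntegral.integral_congr_ae hderiv, hac.integral_deriv_eq_sub,
      hy.apply_zero]

theorem StandingAssumption.ofReal_integral_le_lintegral (hP : P.StandingAssumption)
    (hu : IsAdmissible u) (hy : ContinuousOn y (Ici 0)) {a b : ℝ} (ha : 0 ≤ a) (hab : a ≤ b) :
    ENNReal.ofReal (∫ s in a..b, P.runningCost (y s) (u s))
      ≤ ∫⁻ t in Ici (0 : ℝ), ENNReal.ofReal (P.runningCost (y t) (u t)) := by
  have hi := hu.intervalIntegrable_runningCost hP hy ha hab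
  rw [intervalIntegrable_iff_integrableOn_Ioc_of_le hab] at hi
  rw [intervalIntegral.integral_of_le hab, ofReal_integral_eq_lintegral_ofReal hi
    (Filter.Eventually.of_forall fun s => hP.runningCost_nonneg _ _)]
  exact lintegral_mono_set fun s hs => ha.trans hs.1.le

/-- Dynamic programming inequality along trajectories on a finite horizon. -/
theorem IsTrajectory.le_add_integral_runningCost (hP : P.StandingAssumption)
    (hu : IsAdmissible u) (hy : P.IsTrajectory x u y) {v : EuclideanSpace ℝ (Fin N) → ℝ}
    {Ω : Set (EuclideanSpace ℝ (Fin N))} (hΩ : IsOpen Ω) (hv : ContDiffOn ℝ 1 v Ω)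
    (hHJB : P.SatisfiesHJB v Ω) {r T : ℝ} (hr : Metric.closedBall 0 r ⊆ Ω) (hT : 0 ≤ T)
    (hyr : ∀ t ∈ Icc 0 T, ‖y t‖ ≤ r) :
    v x ≤ v (y T) + ∫ s in (0 : ℝ)..T, P.runningCost (y s) (u s) := by
  obtain ⟨hi, heq⟩ := hy.integral_fderiv hP hu hΩ hv hr hT hyr
  have h1 : ∫ s in (0 : ℝ)..T, -P.runningCost (y s) (u s)
      ≤ ∫ s in (0 : ℝ)..T, fderiv ℝ v (y s) (P.dynamics (y s) (u s)) :=
    intervalIntegral.integral_mono_on hT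
      (hu.intervalIntegrable_runningCost hP hy.1 le_rfl hT).neg hi fun s hs =>
        hP.neg_runningCost_le_fderiv hHJB (hr (mem_closedBall_zero_iff.2 (hyr s hs))) _
  rw [heq, intervalIntegral.integral_neg] at h1
  linarith

/-- A trajectory that stays in a ball contained in `Ω` costs at least `v x`. -/
theorem IsTrajectory.ofReal_le_lintegral_of_norm_le (hP : P.StandingAssumption)
    (hu : IsAdmissible u) (hy : P.IsTrajectory x u y) {v : EuclideanSpace ℝ (Fin N) → ℝ}
    {Ω : Set (EuclideanSpace ℝ (Fin N))} (hΩ : IsOpen Ω) (hv : ContDiffOn ℝ 1 v Ω)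
    (hv_zero : v 0 = 0) (hHJB : P.SatisfiesHJB v Ω) {r : ℝ} (hr : Metric.closedBall 0 r ⊆ Ω)
    (hyr : ∀ t, 0 ≤ t → ‖y t‖ ≤ r) :
    ENNReal.ofReal (v x)
      ≤ ∫⁻ t in Ici (0 : ℝ), ENNReal.ofReal (P.runningCost (y t) (u t)) := by
  rcases eq_or_ne (∫⁻ t in Ici (0 : ℝ), ENNReal.ofReal (P.runningCost (y t) (u t))) ∞ with
    htop | htop
  · rw [htop]
    exact le_top
  have hmem : ∀ t, 0 ≤ t → y t ∈ Metric.closedBall (0 : EuclideanSpace ℝ (Fin N)) r :=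
    fun t ht => mem_closedBall_zero_iff.2 (hyr t ht)
  -- Convergence to the origin is not needed. If `v ≥ ε` held forever, the curve would stay in a
  -- compact set avoiding `0`, where `h` has a positive minimum, and the cost would be infinite.
  have hsmall : ∀ ε > 0, ∃ T, 0 ≤ T ∧ v (y T) < ε := by
    intro ε hε
    by_contra! hcon
    have hK : IsCompact (Metric.closedBall (0 : EuclideanSpace ℝ (Fin N)) r ∩ v ⁻¹' Ici ε) :=
      (isCompact_closedBall _ _).of_isClosed_subset
        ((hv.continuousOn.mono hr).preimage_isClosed_of_isClosed Metric.isClosed_closedBall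
          isClosed_Ici) inter_subset_left
    obtain ⟨z, hz, hmin⟩ := hK.exists_isMinOn ⟨y 0, hmem 0 le_rfl, hcon 0 le_rfl⟩
      hP.contDiff_h.continuous.continuousOn
    have hz0 : z ≠ 0 := by
      rintro rfl
      have : ε ≤ v 0 := hz.2
      linarith
    have hpos := hP.h_pos z hz0
    apply htop
    rw [eq_top_iff]
    calc (∞ : ℝ≥0∞) = ∫⁻ _ in Ici (0 : ℝ), ENNReal.ofReal (P.h z) := by
          rw [setLIntegral_const, Real.volume_Ici, ENNReal.mul_top]
          simpa using hpos
      _ ≤ _ := setLIntegral_mono' measurableSet_Ici fun t ht =>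
          ENNReal.ofReal_le_ofReal
            ((hmin ⟨hmem t ht, hcon t ht⟩).trans (hP.h_le_runningCost _ _))
  rw [ENNReal.ofReal_le_iff_le_toReal htop]
  refine le_of_forall_pos_le_add fun ε hε => ?_
  obtain ⟨T, hT, hvT⟩ := hsmall ε hε
  have h1 := hy.le_add_integral_runningCost hP hu hΩ hv hHJB hr hT fun t ht => hyr t ht.1
  have h2 := (ENNReal.ofReal_le_iff_le_toReal htop).1
    (hP.ofReal_integral_le_lintegral hu hy.1 le_rfl hT)
  linarith

/-- Leaving a large ball from a smaller one has a cost that is bounded below. -/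
theorem IsTrajectory.le_lintegral_of_escape (hP : P.StandingAssumption)
    (hu : IsAdmissible u) (hy : P.IsTrajectory x u y) {ρ r C : ℝ} (hρr : ρ ≤ r) (hC0 : 0 < C)
    (hC : ∀ x : EuclideanSpace ℝ (Fin N), ρ ≤ ‖x‖ → ‖x‖ ≤ r →
      ∀ u : EuclideanSpace ℝ (Fin M), ‖P.dynamics x u‖ ≤ C * P.runningCost x u)
    (hx : ‖x‖ ≤ ρ) {t : ℝ} (ht : 0 ≤ t) (hyt : r ≤ ‖y t‖) :
    ENNReal.ofReal ((r - ρ) / C)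
      ≤ ∫⁻ t in Ici (0 : ℝ), ENNReal.ofReal (P.runningCost (y t) (u t)) := by
  -- On one complete crossing of the annulus the displacement is at least `r - ρ`, and the speed is
  -- controlled by the cost throughout.
  obtain ⟨σ, τ, hσ, hστ, -, hyσ, hyτ, hbd⟩ := exists_crossing ht
    (hy.1.norm.mono Icc_subset_Ici_self) hρr (by rwa [hy.apply_zero]) hyt
  have h1 : r - ρ ≤ ‖y τ - y σ‖ := by
    rw [← hyσ, ← hyτ]
    exact norm_sub_norm_le _ _
  have h2 : ‖y τ - y σ‖ ≤ ∫ s in σ..τ, C * P.runningCost (y s) (u s) := by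
    rw [hy.sub_eq_integral hσ (hσ.trans hστ)]
    refine intervalIntegral.norm_integral_le_of_norm_le hστ ?_
      ((hu.intervalIntegrable_runningCost hP hy.1 hσ hστ).const_mul C)
    refine Filter.Eventually.of_forall fun s hs => ?_
    obtain ⟨h3, h4⟩ := hbd s ⟨hs.1.le, hs.2⟩
    exact hC _ h3 h4 _
  rw [intervalIntegral.integral_const_mul] at h2
  refine le_trans (ENNReal.ofReal_le_ofReal ?_) (hP.ofReal_integral_le_lintegral hu hy.1 hσ hστ)
  rw [div_le_iff₀ hC0]
  linarith

/-- Lower bound for the value function near the origin. -/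
theorem StandingAssumption.ofReal_le_valueFunction (hP : P.StandingAssumption)
    {v : EuclideanSpace ℝ (Fin N) → ℝ} {Ω : Set (EuclideanSpace ℝ (Fin N))} (hΩ : IsOpen Ω)
    (hv : ContDiffOn ℝ 1 v Ω) (hv_zero : v 0 = 0) (hHJB : P.SatisfiesHJB v Ω) {ρ r C : ℝ}
    (hρr : ρ ≤ r) (hr : Metric.closedBall 0 r ⊆ Ω) (hC0 : 0 < C)
    (hC : ∀ x : EuclideanSpace ℝ (Fin N), ρ ≤ ‖x‖ → ‖x‖ ≤ r →
      ∀ u : EuclideanSpace ℝ (Fin M), ‖P.dynamics x u‖ ≤ C * P.runningCost x u)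
    (hx : ‖x‖ ≤ ρ) (hvx : v x ≤ (r - ρ) / C) :
    ENNReal.ofReal (v x) ≤ P.valueFunction x := by
  refine le_iInf₂ fun u hu => le_iInf₂ fun y hy => ?_
  by_cases hyr : ∀ t, 0 ≤ t → ‖y t‖ ≤ r
  · exact hy.ofReal_le_lintegral_of_norm_le hP hu hΩ hv hv_zero hHJB hr hyr
  · push Not at hyr
    obtain ⟨t, ht, hyt⟩ := hyr
    exact (ENNReal.ofReal_le_ofReal hvx).trans
      (hy.le_lintegral_of_escape hP hu hρr hC0 hC hx ht hyt.le)

end ControlProblem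

/-! ### Closed-loop solutions: invariance, existence, upper bound -/

namespace ControlProblem

variable {N M : ℕ} {P : ControlProblem N M} {x : EuclideanSpace ℝ (Fin N)}
  {y : ℝ → EuclideanSpace ℝ (Fin N)} {v : EuclideanSpace ℝ (Fin N) → ℝ}
  {Ω : Set (EuclideanSpace ℝ (Fin N))}

/-- A solution of the HJB equation decreases along closed-loop solutions in `Ω`. -/
theorem SatisfiesHJB.apply_le_of_hasDerivWithinAt (hHJB : P.SatisfiesHJB v Ω)
    (hP : P.StandingAssumption) (hΩ : IsOpen Ω) (hv : ContDiffOn ℝ 1 v Ω) {T : ℝ} (hT : 0 ≤ T)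
    (hyΩ : ∀ t ∈ Icc 0 T, y t ∈ Ω)
    (hy : ∀ t ∈ Icc 0 T, HasDerivWithinAt y (P.dynamics (y t) (P.feedback v (y t))) (Icc 0 T) t) :
    v (y T) ≤ v (y 0) := by
  have hderiv : ∀ t ∈ interior (Icc 0 T), HasDerivWithinAt (fun t => v (y t))
      (-P.runningCost (y t) (P.feedback v (y t))) (interior (Icc 0 T)) t := by
    intro t ht
    have htT := interior_subset ht
    have hvd : DifferentiableAt ℝ v (y t) :=
      (hv.differentiableOn one_ne_zero).differentiableAt (hΩ.mem_nhds (hyΩ t htT))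
    rw [← hHJB.fderiv_feedback (hyΩ t htT)]
    exact hvd.hasFDerivAt.comp_hasDerivWithinAt t ((hy t htT).mono interior_subset)
  have hanti : AntitoneOn (fun t => v (y t)) (Icc 0 T) :=
    antitoneOn_of_hasDerivWithinAt_nonpos (convex_Icc 0 T)
      (hv.continuousOn.comp (fun t ht => (hy t ht).continuousWithinAt) hyΩ) hderiv
      fun t _ => neg_nonpos.2 (hP.runningCost_nonneg _ _)
  exact hanti (left_mem_Icc.2 hT) (right_mem_Icc.2 hT) hT

/-- Sublevel sets of a solution of the HJB equation inside a small ball are invariant. Only the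
behaviour of the vector field on the closed ball matters. -/
theorem SatisfiesHJB.norm_lt_and_lt_of_hasDerivWithinAt (hHJB : P.SatisfiesHJB v Ω)
    (hP : P.StandingAssumption) (hΩ : IsOpen Ω) (hv : ContDiffOn ℝ 1 v Ω) {ρ m : ℝ}
    (hρ : Metric.closedBall 0 ρ ⊆ Ω) (hm : ∀ z, ‖z‖ = ρ → m ≤ v z)
    {T : ℝ} (hT : 0 ≤ T) (hyc : ContinuousOn y (Icc 0 T))
    (hy : ∀ t ∈ Icc 0 T, ‖y t‖ ≤ ρ →
      HasDerivWithinAt y (P.dynamics (y t) (P.feedback v (y t))) (Icc 0 T) t)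
    (hy0 : ‖y 0‖ < ρ) (hvy0 : v (y 0) < m) : ‖y T‖ < ρ ∧ v (y T) < m := by
  have key : ∀ τ ∈ Icc 0 T, (∀ s ∈ Icc 0 τ, ‖y s‖ ≤ ρ) → v (y τ) < m := by
    intro τ hτ hle
    have hsub : Icc 0 τ ⊆ Icc 0 T := Icc_subset_Icc_right hτ.2
    refine (hHJB.apply_le_of_hasDerivWithinAt hP hΩ hv hτ.1
      (fun t ht => hρ (mem_closedBall_zero_iff.2 (hle t ht)))
      fun t ht => (hy t (hsub ht) (hle t ht)).mono hsub).trans_lt hvy0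
  have hlt : ∀ t ∈ Icc 0 T, ‖y t‖ < ρ := by
    intro t ht
    by_contra! hge
    -- At the first arrival on the sphere `v` is still below `m`, contradicting the lower bound
    -- there.
    obtain ⟨τ, hτ, hτρ, hle⟩ := exists_first_hit ht.1
      (hyc.norm.mono (Icc_subset_Icc_right ht.2)) hy0.le hge
    exact (key τ ⟨hτ.1, hτ.2.trans ht.2⟩ hle).not_ge (hm _ hτρ)
  exact ⟨hlt T ⟨hT, le_rfl⟩, key T ⟨hT, le_rfl⟩ fun s hs => (hlt s hs).le⟩

theorem IsClosedLoop.mono {k : EuclideanSpace ℝ (Fin N) → EuclideanSpace ℝ (Fin M)}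
    {I J : Set ℝ} (hy : P.IsClosedLoop k x J y) (hIJ : I ⊆ J) : P.IsClosedLoop k x I y :=
  ⟨hy.1, fun t ht => (hy.2 t (hIJ ht)).mono hIJ⟩

theorem IsClosedLoop.continuousOn {k : EuclideanSpace ℝ (Fin N) → EuclideanSpace ℝ (Fin M)}
    {I : Set ℝ} (hy : P.IsClosedLoop k x I y) : ContinuousOn y I :=
  fun t ht => (hy.2 t ht).continuousWithinAt

/-- Existence of global closed-loop solutions that start in a small sublevel set. -/
theorem SatisfiesHJB.exists_isClosedLoop (hHJB : P.SatisfiesHJB v Ω)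
    (hP : P.StandingAssumption) (hΩ : IsOpen Ω) (hv : ContDiffOn ℝ 1 v Ω) {ρ m : ℝ}
    (hρ0 : 0 < ρ) (hρ : Metric.closedBall 0 ρ ⊆ Ω) (hm : ∀ z, ‖z‖ = ρ → m ≤ v z)
    (hx : ‖x‖ < ρ) (hvx : v x < m) :
    ∃ y, P.IsClosedLoop (P.feedback v) x (Ici 0) y := by
  let G : EuclideanSpace ℝ (Fin N) → EuclideanSpace ℝ (Fin N) :=
    fun z => P.dynamics z (P.feedback v z)
  have hGc : ContinuousOn G (Metric.closedBall 0 ρ) :=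
    hP.continuous_dynamics.comp_continuousOn
      (continuousOn_id.prodMk ((hP.continuousOn_feedback hΩ hv).mono hρ))
  have hmem : ∀ z : EuclideanSpace ℝ (Fin N), radialRetraction ρ z ∈ Metric.closedBall 0 ρ :=
    fun z => mem_closedBall_zero_iff.2 (norm_radialRetraction_le hρ0 z)
  obtain ⟨K, hK⟩ := (isCompact_closedBall (0 : EuclideanSpace ℝ (Fin N)) ρ
    ).exists_bound_of_continuousOn hGc
  -- Composition with the retraction makes the field bounded and continuous on the whole space. It
  -- is unchanged on the ball, which the invariance argument then shows the solution never leaves.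
  obtain ⟨y, hy0, hy⟩ := exists_global_solution_of_continuous_of_bounded
    (hGc.comp_continuous (continuous_radialRetraction hρ0) hmem) (fun z => hK _ (hmem z)) x
  refine ⟨y, hy0, fun t ht => ?_⟩
  have hlt : ‖y t‖ < ρ := by
    refine (hHJB.norm_lt_and_lt_of_hasDerivWithinAt hP hΩ hv hρ hm ht
      (fun s hs => (hy s hs.1).continuousWithinAt.mono Icc_subset_Ici_self)
      (fun s hs hle => ?_) (by rwa [hy0]) (by rwa [hy0])).1
    have := (hy s hs.1).mono (Icc_subset_Ici_self : Icc 0 t ⊆ Ici 0)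
    rwa [Function.comp_apply, radialRetraction_of_norm_le hρ0 hle] at this
  have := hy t ht
  rwa [Function.comp_apply, radialRetraction_of_norm_le hρ0 hlt.le] at this

/-- Closed-loop solutions that stay in a compact ball are trajectories of an admissible input,
with cost at most `v x`. -/
theorem IsClosedLoop.isAdmissible_and_cost_le (hP : P.StandingAssumption) (hΩ : IsOpen Ω)
    (hv : ContDiffOn ℝ 1 v Ω) (hv_nonneg : ∀ x ∈ Ω, 0 ≤ v x) (hHJB : P.SatisfiesHJB v Ω) {ρ : ℝ}
    (hρ : Metric.closedBall 0 ρ ⊆ Ω) (hy : P.IsClosedLoop (P.feedback v) x (Ici 0) y)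
    (hyρ : ∀ t, 0 ≤ t → ‖y t‖ ≤ ρ) :
    IsAdmissible (fun t => P.feedback v (y t)) ∧
      P.cost x (fun t => P.feedback v (y t)) ≤ ENNReal.ofReal (v x) := by
  have hmem : ∀ t ∈ Ici (0 : ℝ), y t ∈ Metric.closedBall (0 : EuclideanSpace ℝ (Fin N)) ρ :=
    fun t ht => mem_closedBall_zero_iff.2 (hyρ t ht)
  have hkc := (hP.continuousOn_feedback hΩ hv).mono hρ
  have huc : ContinuousOn (fun t => P.feedback v (y t)) (Ici 0) := hkc.comp hy.continuousOn hmem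
  obtain ⟨K, hK⟩ := (isCompact_closedBall (0 : EuclideanSpace ℝ (Fin N)) ρ
    ).exists_bound_of_continuousOn hkc
  have hu : IsAdmissible (fun t => P.feedback v (y t)) := by
    refine memLp_top_of_bound (huc.aestronglyMeasurable measurableSet_Ici) K ?_
    filter_upwards [ae_restrict_mem measurableSet_Ici] with t ht
    exact hK _ (hmem t ht)
  have hdc : ContinuousOn (fun t => P.dynamics (y t) (P.feedback v (y t))) (Ici 0) :=
    hP.continuous_dynamics.comp_continuousOn (hy.continuousOn.prodMk huc)
  have htraj : P.IsTrajectory x (fun t => P.feedback v (y t)) y := by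
    refine ⟨hy.continuousOn, fun t ht => ?_⟩
    have hi : IntervalIntegrable (fun t => P.dynamics (y t) (P.feedback v (y t))) volume 0 t :=
      (hdc.mono Icc_subset_Ici_self).intervalIntegrable_of_Icc ht
    refine ⟨hi, ?_⟩
    rw [intervalIntegral.integral_eq_sub_of_hasDerivAt_of_le ht
      (hy.continuousOn.mono Icc_subset_Ici_self)
      (fun s hs => (hy.2 s hs.1.le).hasDerivAt (Ici_mem_nhds hs.1)) hi, hy.1]
    abel
  -- The closed-loop curve competes in the infimum defining the cost, so uniqueness of trajectories
  -- plays no role here.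
  refine ⟨hu, (iInf₂_le y htraj).trans ?_⟩
  -- Up to time `n` the cost equals `v x - v (y n)`, at most `v x`; exhausting `[0, ∞)` gives the
  -- full bound.
  have hfin : ∀ n : ℕ, ∫⁻ t in Icc (0 : ℝ) n,
      ENNReal.ofReal (P.runningCost (y t) (P.feedback v (y t))) ≤ ENNReal.ofReal (v x) := by
    intro n
    have hn : (0 : ℝ) ≤ n := n.cast_nonneg
    have h1 := (htraj.integral_fderiv hP hu hΩ hv hρ hn fun t ht => hyρ t ht.1).2
    have h2 : ∫ s in (0 : ℝ)..n, fderiv ℝ v (y s) (P.dynamics (y s) (P.feedback v (y s)))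
        = ∫ s in (0 : ℝ)..n, -P.runningCost (y s) (P.feedback v (y s)) :=
      intervalIntegral.integral_congr fun s hs => by
        rw [uIcc_of_le hn] at hs
        exact hHJB.fderiv_feedback (hρ (hmem s hs.1))
    rw [h2, intervalIntegral.integral_neg, intervalIntegral.integral_of_le hn,
      ← integral_Icc_eq_integral_Ioc] at h1
    have h3 := (hu.bounded_and_integrableOn hy.continuousOn hP.continuous_runningCost (n : ℝ)).2
    rw [← ofReal_integral_eq_lintegral_ofReal h3
      (Filter.Eventually.of_forall fun s => hP.runningCost_nonneg _ _)]
    have h4 := hv_nonneg _ (hρ (hmem n hn))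
    exact ENNReal.ofReal_le_ofReal (by linarith)
  have hunion : Ici (0 : ℝ) = ⋃ n : ℕ, Icc (0 : ℝ) n := by
    ext t
    simp only [mem_Ici, mem_iUnion, mem_Icc, exists_and_left]
    exact ⟨fun h => ⟨h, exists_nat_ge t⟩, fun h => h.1⟩
  rw [hunion, setLIntegral_iUnion_of_directed]
  · exact iSup_le hfin
  · refine Monotone.directed_le fun a b hab => Icc_subset_Icc_right ?_
    exact_mod_cast hab

/-- Radii and a level for which the sublevel set is a well-behaved neighbourhood of the origin. -/
theorem StandingAssumption.exists_level (hP : P.StandingAssumption) (hΩ : IsOpen Ω)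
    (hΩ_zero : 0 ∈ Ω) (hv : ContDiffOn ℝ 1 v Ω) (hv_nonneg : ∀ x ∈ Ω, 0 ≤ v x)
    (hHJB : P.SatisfiesHJB v Ω) :
    ∃ ρ r C m : ℝ, 0 < ρ ∧ ρ ≤ r ∧ 0 < C ∧ 0 < m ∧ Metric.closedBall 0 r ⊆ Ω ∧
      (∀ x : EuclideanSpace ℝ (Fin N), ρ ≤ ‖x‖ → ‖x‖ ≤ r →
        ∀ u : EuclideanSpace ℝ (Fin M), ‖P.dynamics x u‖ ≤ C * P.runningCost x u) ∧
      m ≤ (r - ρ) / C ∧ ∀ z, ‖z‖ = ρ → m ≤ v z := by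
  obtain ⟨r, hr0, hr⟩ := Metric.nhds_basis_closedBall.mem_iff.1 (hΩ.mem_nhds hΩ_zero)
  obtain ⟨C, hC0, hC⟩ := hP.exists_norm_dynamics_le (r := r) (half_pos hr0)
  have hsub : Metric.sphere (0 : EuclideanSpace ℝ (Fin N)) (r / 2) ⊆ Ω := fun z hz =>
    hr (mem_closedBall_zero_iff.2 ((mem_sphere_zero_iff_norm.1 hz).le.trans (by linarith)))
  obtain ⟨m, hm0, hm⟩ : ∃ m > 0, ∀ z : EuclideanSpace ℝ (Fin N), ‖z‖ = r / 2 → m ≤ v z := by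
    rcases (Metric.sphere (0 : EuclideanSpace ℝ (Fin N)) (r / 2)).eq_empty_or_nonempty with h | h
    · refine ⟨1, one_pos, fun z hz => ?_⟩
      have : z ∈ Metric.sphere (0 : EuclideanSpace ℝ (Fin N)) (r / 2) :=
        mem_sphere_zero_iff_norm.2 hz
      rw [h] at this
      exact this.elim
    · obtain ⟨z, hz, hmin⟩ := (isCompact_sphere _ _).exists_isMinOn h (hv.continuousOn.mono hsub)
      have hz0 : z ≠ 0 := norm_pos_iff.1 (by rw [mem_sphere_zero_iff_norm.1 hz]; linarith)
      exact ⟨v z, hP.pos_of_satisfiesHJB hΩ hv_nonneg hHJB (hsub hz) hz0,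
        fun w hw => hmin (mem_sphere_zero_iff_norm.2 hw)⟩
  -- The first term of the minimum gives invariance; the second makes escape from the larger ball
  -- cost at least the level.
  refine ⟨r / 2, r, C, min m ((r - r / 2) / C), half_pos hr0, by linarith, hC0,
    lt_min hm0 (div_pos (by linarith) hC0), hr, hC, min_le_right _ _,
    fun z hz => (min_le_left _ _).trans (hm z hz)⟩

end ControlProblem

end OptimalControl

/-! ### Optimality on the sublevel set -/

theorem mainTheorem3 {N M : ℕ} (P : OptimalControl.ControlProblem N M)
    (hP : P.StandingAssumption)
    (Ω : Set (EuclideanSpace ℝ (Fin N)))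
    (hΩ_open : IsOpen Ω) (hΩ_conn : IsConnected Ω) (hΩ_zero : 0 ∈ Ω)
    (hval : P.ValueFunctionContDiffOn Ω)
    (v : EuclideanSpace ℝ (Fin N) → ℝ) (hv : ContDiffOn ℝ 1 v Ω)
    (hv_nonneg : ∀ x ∈ Ω, 0 ≤ v x) (hv_zero : v 0 = 0)
    (hv_HJB : P.SatisfiesHJB v Ω) :
    ∃ Ω' : Set (EuclideanSpace ℝ (Fin N)),
      Ω' ⊆ Ω ∧ Ω' ∈ 𝓝 (0 : EuclideanSpace ℝ (Fin N)) ∧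
      (∀ x ∈ Ω', P.valueFunction x = ENNReal.ofReal (v x)) ∧
      P.IsOptimalFeedbackOn (P.feedback v) Ω' := by
  obtain ⟨ρ, r, C, m, hρ0, hρr, hC0, hm0, hr, hC, hmC, hm⟩ :=
    hP.exists_level hΩ_open hΩ_zero hv hv_nonneg hv_HJB
  have hρ : Metric.closedBall 0 ρ ⊆ Ω := (Metric.closedBall_subset_closedBall hρr).trans hr
  have hlower : ∀ x, ‖x‖ < ρ → v x < m → ENNReal.ofReal (v x) ≤ P.valueFunction x :=
    fun x hx hvx => hP.ofReal_le_valueFunction hΩ_open hv hv_zero hv_HJB hρr hr hC0 hC hx.le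
      (hvx.le.trans hmC)
  have hinv : ∀ x, ‖x‖ < ρ → v x < m → ∀ T, 0 ≤ T → ∀ y,
      P.IsClosedLoop (P.feedback v) x (Icc 0 T) y → ∀ t ∈ Icc 0 T, ‖y t‖ < ρ ∧ v (y t) < m := by
    intro x hx hvx T _ y hy t ht
    have hyt := hy.mono (Icc_subset_Icc_right ht.2)
    exact hv_HJB.norm_lt_and_lt_of_hasDerivWithinAt hP hΩ_open hv hρ hm ht.1
      hyt.continuousOn (fun s hs _ => hyt.2 s hs) (by rwa [hy.1]) (by rwa [hy.1])
  have hupper : ∀ x, ‖x‖ < ρ → v x < m → ∀ y, P.IsClosedLoop (P.feedback v) x (Ici 0) y →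
      OptimalControl.ControlProblem.IsAdmissible (fun t => P.feedback v (y t)) ∧
        P.cost x (fun t => P.feedback v (y t)) ≤ ENNReal.ofReal (v x) := by
    intro x hx hvx y hy
    exact hy.isAdmissible_and_cost_le hP hΩ_open hv hv_nonneg hv_HJB hρ fun t ht =>
      (hinv x hx hvx t ht y (hy.mono Icc_subset_Ici_self) t ⟨ht, le_rfl⟩).1.le
  have hle : ∀ x (u : ℝ → EuclideanSpace ℝ (Fin M)),
      OptimalControl.ControlProblem.IsAdmissible u → P.valueFunction x ≤ P.cost x u :=
    fun x u hu => iInf₂_le u hu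
  have heq : ∀ x, ‖x‖ < ρ → v x < m → P.valueFunction x = ENNReal.ofReal (v x) := by
    intro x hx hvx
    obtain ⟨y, hy⟩ := hv_HJB.exists_isClosedLoop hP hΩ_open hv hρ0 hρ hm hx hvx
    obtain ⟨hu, hcost⟩ := hupper x hx hvx y hy
    exact le_antisymm ((hle x _ hu).trans hcost) (hlower x hx hvx)
  refine ⟨{x | ‖x‖ < ρ ∧ v x < m}, fun x hx => hρ (mem_closedBall_zero_iff.2 hx.1.le), ?_,
    fun x hx => heq x hx.1 hx.2, fun x hx => ⟨?_, ?_, fun y hy => ?_⟩⟩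
  · have h1 : ∀ᶠ x in 𝓝 (0 : EuclideanSpace ℝ (Fin N)), ‖x‖ < ρ :=
      continuous_norm.continuousAt.eventually_lt continuousAt_const (by simpa using hρ0)
    have h2 : ∀ᶠ x in 𝓝 (0 : EuclideanSpace ℝ (Fin N)), v x < m :=
      (hv.continuousOn.continuousAt (hΩ_open.mem_nhds hΩ_zero)).eventually_lt
        continuousAt_const (by rwa [hv_zero])
    exact h1.and h2
  · exact hv_HJB.exists_isClosedLoop hP hΩ_open hv hρ0 hρ hm hx.1 hx.2
  · exact hinv x hx.1 hx.2
  · obtain ⟨hu, hcost⟩ := hupper x hx.1 hx.2 y hy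
    -- The chain from cost to `v x` to the value function and back to cost closes for each
    -- closed-loop solution separately, so they may be non-unique.
    exact ⟨hu, le_antisymm (hcost.trans (hlower x hx.1 hx.2)) (hle x _ hu)⟩
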